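/- Let $L$ be a finite connected flag complex and let $M\to L$ be a connected regular covering of simplicial complexes, with group of deck transformations $\pi=\pi_1(L)/\pi_1(M)$. Let $A_L$ be the right-angled Artin group of the 1-skeleton of $L$, let $BB_L$ be the Bestvina–Brady group (the kernel of the homomorphism $A_L\to\mathbb{Z}$ sending every standard generator to $1$), and let $\mathbb{B}_L$ be the quotient by $BB_L$ of the universal cover of the Salvetti complex of $A_L$. The cube complex $\mathbb{B}_L$ has exactly one vertex of each height $n\in\mathbb{Z}$, and the link of every vertex is the spherical double $\mathbb{S}(L)$ of $L$, which projects to $L$. For $S\subseteq\mathbb{Z}$ let $X_L^M(S)\to\mathbb{B}_L$ be the branched cover with branching at the vertices of height not in $S$ and with ascending and descending links of the branching vertices isomorphic to $M$. That is, $X_L^M(S)$ is the completion, by adding vertices, of the regular covering of $\mathbb{B}_L$ minus its vertices that corresponds to the normal subgroup of the fundamental group generated by all loops in the links of the vertices of height in $S$, together with those loops in the links of the vertices of height not in $S$ whose projections to $L$ lift to closed loops in $M$. Let $G_L^M(S)$ be the group of deck transformations of $X_L^M(S)\to\mathbb{B}_L$. **Theorem 3.1.** Suppose that $G_L^M(S)$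 is of finite ramification, that is, $\pi$ is finite and nontrivial and $S\neq\mathbb{Z}$. If $G_L^M(S)$ is virtually torsion-free (it has a torsion-free subgroup of finite index), then $S$ is periodic: there is an integer $N>0$ such that, for all $n\in\mathbb{Z}$, $n+N\in S$ if and only if $n\in S$. -/

import Mathlib

universe u w

/-! ## Regular coverings of flag complexes

A flag complex is determined by its 1-skeleton: its simplices are the finite cliques.  So a flag
complex is given here by a simple graph, and a simplicial map that does not collapse edges by a
graph homomorphism.  A covering of a flag complex is again a flag complex. -/

/-- `f : M → L` is a connected regular (Galois) covering of flag complexes: `M` is connected, `f` is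
surjective, `f` restricts to an isomorphism from the star of every vertex `x` onto the star of
`f x` (it is bijective on neighbours, and neighbours of `x` span a triangle with `x` as soon as
their images do), and the automorphisms of `M` over `L` act transitively on the fibres. -/
structure IsRegularCover {V : Type u} {W : Type w} {L : SimpleGraph V} {M : SimpleGraph W}
    (f : M →g L) : Prop where
  connected : M.Connected
  surjective : Function.Surjective f
  bijOn_neighborSet : ∀ x, Set.BijOn f (M.neighborSet x) (L.neighborSet (f x))
  adj_of_adj : ∀ x y z, M.Adj x y → M.Adj x z → L.Adj (f y) (f z) → M.Adj y z
  transitive : ∀ x y, f x = f y → ∃ g : M ≃g M, (∀ z, f (g z) = f z) ∧ g x = y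

/-- The group of deck transformations of `f : M → L`. -/
def coverDeckGroup {V : Type u} {W : Type w} {L : SimpleGraph V} {M : SimpleGraph W}
    (f : M →g L) : Subgroup (M ≃g M) where
  carrier := {g | ∀ x, f (g x) = f x}
  mul_mem' {g h} hg hh x := by
    rw [RelIso.mul_apply, hg, hh]
  one_mem' _ := rfl
  inv_mem' {g} hg x := by
    rw [← hg (g⁻¹ x), ← RelIso.mul_apply, mul_inv_cancel, RelIso.one_apply]

/-! ## The cube complex `B_L`

`B_L` is the quotient of the universal cover of the Salvetti complex of the right-angled Artin group
`A_L` by the Bestvina-Brady group `BB_L`, equivalently the infinite cyclic cover of the Salvetti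
complex that belongs to `A_L → ℤ`.  Explicitly: it has one vertex for every integer `n` (its
height), one edge from `n` to `n + 1` for every vertex `v` of `L`, and one cube for every height `n`
and every clique `σ` of `L`, with bottom vertex `n` and top vertex `n + |σ|`, whose edges at height
`n + j`, for `0 ≤ j < |σ|`, are labelled by the elements of `σ`. -/

/-- The edges of `B_L`: the edge with label `v` from height `bot` to height `bot + 1`. -/
@[ext]
structure BBEdge {V : Type u} (L : SimpleGraph V) where
  bot : ℤ
  label : V

/-- The two endpoints of an edge of `B_L`: bottom (`false`) and top (`true`). -/
def BBEdge.endpoint {V : Type u} {L : SimpleGraph V} (e : BBEdge L) : Bool → ℤ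
  | false => e.bot
  | true => e.bot + 1

/-- The corners of squares of `B_L`: the end `s` of the edge `e` and the end `t` of the edge `e'`
lie at the same vertex of `B_L`, and the labels of `e` and `e'` are adjacent in `L`. Such a pair of
ends is the corner of exactly one square of `B_L`. -/
structure Corner {V : Type u} {L : SimpleGraph V} (e e' : BBEdge L) where
  s : Bool
  t : Bool
  meet : e.endpoint s = e'.endpoint t
  adj : L.Adj e.label e'.label

/-- The edges of `B_L` with the corners as arrows. A path in this quiver is a path in `B_L` minus
its vertices, up to homotopy, that starts and ends on edges and runs from edge to edge across
corners of squares. -/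
instance BBEdge.quiver {V : Type u} {L : SimpleGraph V} : Quiver (BBEdge L) where
  Hom e e' := Corner e e'

/-- Crossing one corner, as a path. -/
def Corner.toPath {V : Type u} {L : SimpleGraph V} {e e' : BBEdge L} (c : Corner e e') :
    Quiver.Path e e' :=
  Quiver.Hom.toPath (V := BBEdge L) c

/-- The 1-skeleton of the link of the vertex `n` in `B_L`: its vertices are the ends of edges at
`n`, and two of them are adjacent if they form a corner of a square. The map `x ↦ x.1.1.label`
exhibits it as the spherical double of `L`. -/
def bbLink {V : Type u} (L : SimpleGraph V) (n : ℤ) :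
    SimpleGraph {x : BBEdge L × Bool // x.1.endpoint x.2 = n} :=
  L.comap fun x => x.1.1.label

/-- A path in the link of the vertex `n`, seen as a path around `n` in `B_L` minus its vertices. -/
def bbLinkPath {V : Type u} {L : SimpleGraph V} {n : ℤ} :
    {x y : {x : BBEdge L × Bool // x.1.endpoint x.2 = n}} → (bbLink L n).Walk x y →
      Quiver.Path x.1.1 y.1.1
  | _, _, .nil => .nil
  | x, _, .cons (v := y) h p =>
      (⟨x.1.2, y.1.2, x.2.trans y.2.symm, h⟩ : Corner x.1.1 y.1.1).toPath.comp (bbLinkPath p)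

/-- The path once around the square of `B_L` with bottom vertex `n` and labels `v`, `w`; its edges
are, in this order, `(n, v)`, `(n, w)`, `(n + 1, v)`, `(n + 1, w)`, and it passes the
corners of the square at the heights `n`, `n + 1`, `n + 2`, `n + 1`. -/
def bbSquarePath {V : Type u} {L : SimpleGraph V} (n : ℤ) {v w : V} (h : L.Adj v w) :
    Quiver.Path (⟨n, v⟩ : BBEdge L) (⟨n, v⟩ : BBEdge L) :=
  let a : BBEdge L := ⟨n, v⟩
  let b : BBEdge L := ⟨n, w⟩
  let c : BBEdge L := ⟨n + 1, v⟩
  let d : BBEdge L := ⟨n + 1, w⟩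
  let ab : Corner a b := ⟨false, false, rfl, h⟩
  let bc : Corner b c := ⟨true, false, rfl, h.symm⟩
  let cd : Corner c d := ⟨true, true, rfl, h⟩
  let da : Corner d a := ⟨false, true, rfl, h.symm⟩
  ((ab.toPath.comp bc.toPath).comp cd.toPath).comp da.toPath

/-! ## The branched cover `X_L^M(S)`

`X_L^M(S)` is the completion, by vertices, of a regular covering of `B_L` minus its vertices. The
covering is the one that belongs to the normal subgroup generated by
* all loops in the links of the vertices with height in `S` (these vertices are not branched), and
* those loops in the links of the vertices with height not in `S` that lift to closed loops in `M`
  (so that the ascending and descending links of the vertices above become copies of `M`). -/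

/-- The projection to `L` of the closed path `p` in the link of a vertex of `B_L` lifts to a closed
path in `M`. (A path in a simple graph is determined by its sequence of vertices.) -/
def LiftsToLoop {V : Type u} {W : Type w} {L : SimpleGraph V} {M : SimpleGraph W} (f : M →g L)
    {n : ℤ} {x : {x : BBEdge L × Bool // x.1.endpoint x.2 = n}} (p : (bbLink L n).Walk x x) :
    Prop :=
  ∃ (a : W) (q : M.Walk a a), q.support.map f = p.support.map fun y => y.1.1.label

/-- The generating homotopies for the paths in `B_L` minus its vertices: a loop that bounds
a square (minus its corners) is trivial, and so is a loop in the link of a vertex with height in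
`S`, or a loop in the link of another vertex whose image in `L` lifts to a loop in `M`. The latter
two kinds include backtracking along a corner, and the triangles that come from
3-dimensional cubes. -/
inductive BranchRel {V : Type u} {W : Type w} {L : SimpleGraph V} {M : SimpleGraph W} (f : M →g L)
    (S : Set ℤ) : HomRel (CategoryTheory.Paths (BBEdge L))
  | square (n : ℤ) {v w : V} (h : L.Adj v w) :
      BranchRel f S (bbSquarePath n h) Quiver.Path.nil
  | unbranched (n : ℤ) (hn : n ∈ S) {x : {x : BBEdge L × Bool // x.1.endpoint x.2 = n}}
      (p : (bbLink L n).Walk x x) : BranchRel f S (bbLinkPath p) Quiver.Path.nil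
  | branched (n : ℤ) (hn : n ∉ S) {x : {x : BBEdge L × Bool // x.1.endpoint x.2 = n}}
      (p : (bbLink L n).Walk x x) (hp : LiftsToLoop f p) :
      BranchRel f S (bbLinkPath p) Quiver.Path.nil

/-- The category (in fact a groupoid) of classes of paths in `B_L` minus its vertices: the quotient
of its fundamental groupoid by the loops listed above. -/
abbrev BranchGroupoid {V : Type u} {W : Type w} {L : SimpleGraph V} {M : SimpleGraph W}
    (f : M →g L) (S : Set ℤ) : Type u :=
  CategoryTheory.Quotient (BranchRel f S)

/-- The edges of `X_L^M(S)`: an edge `edge` of `B_L` with a class of paths to it from the base edge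
`e₀`. -/
structure XEdge {V : Type u} {W : Type w} {L : SimpleGraph V} {M : SimpleGraph W}
    (f : M →g L) (S : Set ℤ) (e₀ : BBEdge L) where
  edge : BBEdge L
  path : (⟨e₀⟩ : BranchGroupoid f S) ⟶ ⟨edge⟩

/-- The end `s` of the edge `p` and the end `t` of the edge `q` form a corner of a square of
`X_L^M(S)`: they project to a corner of a square of `B_L`, across which the class `p` extends to
the class `q`. -/
def XCorner {V : Type u} {W : Type w} {L : SimpleGraph V} {M : SimpleGraph W} {f : M →g L}
    {S : Set ℤ} {e₀ : BBEdge L} (p : XEdge f S e₀) (s : Bool) (q : XEdge f S e₀) (t : Bool) :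
    Prop :=
  ∃ c : Corner p.edge q.edge, c.s = s ∧ c.t = t ∧
    q.path = CategoryTheory.CategoryStruct.comp p.path
      ((CategoryTheory.Quotient.functor (BranchRel f S)).map c.toPath)

/-- The vertices of `X_L^M(S)`: ends of edges, where two ends that form a corner of a square are
identified. -/
def XVertex {V : Type u} {W : Type w} {L : SimpleGraph V} {M : SimpleGraph W} (f : M →g L)
    (S : Set ℤ) (e₀ : BBEdge L) : Type u :=
  Quot fun x y : XEdge f S e₀ × Bool => XCorner x.1 x.2 y.1 y.2

/-- The bottom (`false`) and top (`true`) vertex of an edge of `X_L^M(S)`. -/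
def XEdge.endpoint {V : Type u} {W : Type w} {L : SimpleGraph V} {M : SimpleGraph W} {f : M →g L}
    {S : Set ℤ} {e₀ : BBEdge L} (p : XEdge f S e₀) (s : Bool) : XVertex f S e₀ :=
  Quot.mk _ (p, s)

/-- The generalised Bestvina-Brady group `G_L^M(S)`: the group of deck transformations of the
branched cover `X_L^M(S) → B_L`, that is, of the automorphisms of `X_L^M(S)` over `B_L`. Such an
automorphism is a permutation of the vertices together with a permutation of the edges such that
every edge keeps its image in `B_L`, endpoints (bottom and top) are respected, and corners of
squares go to corners of squares. (The cubes of `X_L^M(S)` are lifts of those of `B_L`, and hence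
are permuted as well.) -/
def GenBestvinaBrady {V : Type u} {W : Type w} {L : SimpleGraph V} {M : SimpleGraph W}
    (f : M →g L) (S : Set ℤ) (e₀ : BBEdge L) :
    Subgroup (Equiv.Perm (XVertex f S e₀) × Equiv.Perm (XEdge f S e₀)) where
  carrier := {g | (∀ p, (g.2 p).edge = p.edge) ∧
    (∀ p s, (g.2 p).endpoint s = g.1 (p.endpoint s)) ∧
    ∀ p s q t, XCorner (g.2 p) s (g.2 q) t ↔ XCorner p s q t}
  mul_mem' {g h} hg hh := by
    refine ⟨fun p => ?_, fun p s => ?_, fun p s q t => ?_⟩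
    · exact (hg.1 _).trans (hh.1 _)
    · exact (hg.2.1 _ _).trans (congrArg g.1 (hh.2.1 _ _))
    · exact (hg.2.2 _ _ _ _).trans (hh.2.2 _ _ _ _)
  one_mem' := ⟨fun _ => rfl, fun _ _ => rfl, fun _ _ _ _ => Iff.rfl⟩
  inv_mem' {g} hg := by
    refine ⟨fun p => ?_, fun p s => ?_, fun p s q t => ?_⟩
    · have h := hg.1 (g.2.symm p)
      rw [Equiv.apply_symm_apply] at h
      exact h.symm
    · have h := hg.2.1 (g.2.symm p) s
      rw [Equiv.apply_symm_apply] at h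
      exact (g.1.symm_apply_eq.mpr h).symm
    · have h := hg.2.2 (g.2.symm p) s (g.2.symm q) t
      rw [Equiv.apply_symm_apply, Equiv.apply_symm_apply] at h
      exact h.symm

/-- `G_L^M(S)` is of finite ramification: the group of deck transformations of `M → L` is finite and
not trivial, and `S ≠ ℤ`. -/
structure FiniteRamification {V : Type u} {W : Type w} {L : SimpleGraph V} {M : SimpleGraph W}
    (f : M →g L) (S : Set ℤ) : Prop where
  finite : Finite (coverDeckGroup f)
  nontrivial : Nontrivial (coverDeckGroup f)
  ne_univ : S ≠ Set.univ

/-- `G` has a subgroup of finite index without nontrivial elements of finite order. -/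
def IsVirtuallyTorsionFree (G : Type*) [Group G] : Prop :=
  ∃ H : Subgroup G, H.FiniteIndex ∧ ∀ g ∈ H, IsOfFinOrder g → g = 1

/-- A set of integers is periodic if it is invariant under a nonzero translation. -/
def IsPeriodicSet (S : Set ℤ) : Prop :=
  ∃ N : ℤ, 0 < N ∧ ∀ n : ℤ, n + N ∈ S ↔ n ∈ S

/-! Fix a nontrivial deck transformation `g` of `M → L` and a path in `M` from `a` to `g a`; let `γ`
be its image in `L`. Copied into the ascending link at height `n`, the loop `γ` gives an element of
finite order (`isOfFinOrder_ascendingClass`), since some power of `γ` lifts to a closed path. It is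
trivial by definition if `n ∈ S`, and nontrivial if `n ∉ S` (`ascendingClass_ne_id`).

The automorphism group of the base edge in `BranchGroupoid` embeds in the deck group, hence is
virtually torsion-free, and `exists_functor_finite_group` supplies a functor to a finite group `Q`
that kills no nontrivial element of finite order. So `n ∈ S` exactly when the image of `γ` at height
`n` is trivial in `Q`. The squares of `B_L` force these images at heights `n` and `n + |Q|` to be
conjugate (`map_ascendingClass_add_exponent`), so `|Q|` is a period of `S`.

The delicate point is the nontriviality for `n ∉ S`: the square relations must not collapse the deck
group of `M → L`. This is shown by exhibiting permutations that satisfy all of them while the deck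
group acts faithfully (`exists_square_action`), built by adding the vertices of `L` one at a time.
-/

/-! ### Solving the square relations over a faithful local group -/

/-- The permutations of `Ω × ℤ` that change the second coordinate by a constant. -/
def heightShiftSubgroup (Ω : Type*) : Subgroup (Equiv.Perm (Ω × ℤ)) where
  carrier := {g | ∃ h : ℤ, ∀ p, (g p).2 = p.2 + h}
  mul_mem' := by
    rintro a b ⟨h, ha⟩ ⟨k, hb⟩
    exact ⟨k + h, fun p => by rw [Equiv.Perm.mul_apply, ha, hb, add_assoc]⟩
  one_mem' := ⟨0, fun p => by simp⟩
  inv_mem' := by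
    rintro a ⟨h, ha⟩
    refine ⟨-h, fun p => ?_⟩
    have := ha (a⁻¹ p)
    rw [Equiv.Perm.inv_def, Equiv.apply_symm_apply] at this
    rw [Equiv.Perm.inv_def]
    omega

/-- The permutation `(ω, n) ↦ (s n ω, n + 1)` of `Ω × ℤ`. -/
def raisePerm {Ω : Type*} (s : ℤ → Equiv.Perm Ω) : Equiv.Perm (Ω × ℤ) where
  toFun p := (s p.2 p.1, p.2 + 1)
  invFun p := ((s (p.2 - 1))⁻¹ p.1, p.2 - 1)
  left_inv p := by simp
  right_inv p := by simp

theorem raisePerm_mem {Ω : Type*} (s : ℤ → Equiv.Perm Ω) :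
    raisePerm s ∈ heightShiftSubgroup Ω :=
  ⟨1, fun _ => rfl⟩

/-- The conjugate by `a` of the unit translation of `Ω × ℤ` in the second coordinate. -/
def conjRaise {Ω : Type*} (a : heightShiftSubgroup Ω) : Equiv.Perm (Ω × ℤ) :=
  a.1 * raisePerm (fun _ => 1) * a.1⁻¹

theorem conjRaise_snd {Ω : Type*} (a : heightShiftSubgroup Ω) (p : Ω × ℤ) :
    (conjRaise a p).2 = p.2 + 1 := by
  obtain ⟨a, h, ha⟩ := a
  have h1 := ha (raisePerm (fun _ => 1) (a⁻¹ p))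
  have h2 := ha (a⁻¹ p)
  rw [Equiv.Perm.inv_def, Equiv.apply_symm_apply, ← Equiv.Perm.inv_def] at h2
  simp only [conjRaise, Equiv.Perm.mul_apply, h1]
  simp only [raisePerm, Equiv.coe_fn_mk]
  omega

/-- At height `n`, the map that follows `conjRaise a` on the slice with parameter `a`. -/
def slicePerm {Ω : Type*} (n : ℤ) : Equiv.Perm (Ω × heightShiftSubgroup Ω) where
  toFun p := ((conjRaise p.2 (p.1, n)).1, p.2)
  invFun p := (((conjRaise p.2)⁻¹ (p.1, n + 1)).1, p.2)
  left_inv p := by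
    have h : ((conjRaise p.2 (p.1, n)).1, n + 1) = conjRaise p.2 (p.1, n) :=
      Prod.ext rfl (conjRaise_snd p.2 (p.1, n)).symm
    simp only [h]
    exact Prod.ext (congrArg (fun q : Ω × ℤ => q.1) ((conjRaise p.2).symm_apply_apply (p.1, n))) rfl
  right_inv p := by
    have h : (((conjRaise p.2)⁻¹ (p.1, n + 1)).1, n) = (conjRaise p.2)⁻¹ (p.1, n + 1) := by
      refine Prod.ext rfl ?_
      have := conjRaise_snd p.2 ((conjRaise p.2)⁻¹ (p.1, n + 1))
      rw [Equiv.Perm.inv_def, Equiv.apply_symm_apply, ← Equiv.Perm.inv_def] at this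
      simp only at this ⊢
      omega
    simp only [h]
    exact Prod.ext (congrArg (fun q : Ω × ℤ => q.1) ((conjRaise p.2).apply_symm_apply (p.1, n + 1))) rfl

/-- Left multiplication of the parameter `a` by `r = raisePerm s` conjugates `conjRaise a` by `r`,
so `r` intertwines the two slices. Read at height `n`, this is the square relation between a new
vertex, transported by `slicePerm`, and an old neighbour, transported by `s`. -/
theorem slicePerm_raise {Ω : Type*} (s : ℤ → Equiv.Perm Ω) (n : ℤ)
    (ω : Ω) (a : heightShiftSubgroup Ω) :
    slicePerm (n + 1) (s n ω, ⟨raisePerm s, raisePerm_mem s⟩ * a) =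
      (s (n + 1) (slicePerm n (ω, a)).1, ⟨raisePerm s, raisePerm_mem s⟩ * a) := by
  refine Prod.ext ?_ rfl
  have h1 : (s n ω, n + 1) = raisePerm s (ω, n) := rfl
  have h2 : conjRaise (⟨raisePerm s, raisePerm_mem s⟩ * a) (raisePerm s (ω, n)) =
      raisePerm s (conjRaise a (ω, n)) := by
    simp [conjRaise, Equiv.Perm.mul_apply]
  have h3 : (conjRaise a (ω, n)) = ((slicePerm n (ω, a)).1, n + 1) :=
    Prod.ext rfl (conjRaise_snd _ _)
  change (conjRaise (⟨raisePerm s, raisePerm_mem s⟩ * a) (s n ω, n + 1)).1 = _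
  rw [h1, h2, h3]
  rfl

/-- The relation given by the square of `B_L` with bottom vertex `n` and labels `v`, `w`, for a
transport `t` along the edges and holonomies `ρ` at the corners. -/
def SquareRel {V : Type*} {G : Type*} [Group G] (ρ : ℤ → V → V → G) (t : ℤ → V → G)
    (n : ℤ) (v w : V) : Prop :=
  t (n + 1) w * ρ (n + 1) v w * t n v =
    ρ (n + 2) v w * t (n + 1) v * ρ (n + 1) w v * t n w * ρ n v w

theorem SquareRel.symm {V : Type*} {G : Type*} [Group G] {ρ : ℤ → V → V → G} {t : ℤ → V → G}
    {n : ℤ} {v w : V} (hρ : ∀ n, ρ n w v = (ρ n v w)⁻¹) (h : SquareRel ρ t n v w) :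
    SquareRel ρ t n w v := by
  unfold SquareRel at *
  rw [hρ n, hρ (n + 2), mul_assoc ((ρ (n + 2) v w)⁻¹), mul_assoc ((ρ (n + 2) v w)⁻¹),
    mul_assoc ((ρ (n + 2) v w)⁻¹), h]
  group

/-- For every cocycle on the edges of `L` at every height with values in `D`, the group `D` embeds
in a group of permutations where the square relations have a solution: the local groups of
a complex of groups over `B_L` inject. -/
theorem exists_square_action {V : Type u} [Finite V] (L : SimpleGraph V) {D : Type w} [Group D]
    (ρ : ℤ → V → V → D) (hsymm : ∀ n v w, L.Adj v w → ρ n w v = (ρ n v w)⁻¹)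
    (htri : ∀ n u v w, L.Adj u v → L.Adj v w → L.Adj u w → ρ n v w * ρ n u v = ρ n u w) :
    ∃ (Ω : Type w) (ι : D →* Equiv.Perm Ω) (t : ℤ → V → Equiv.Perm Ω),
      Function.Injective ι ∧
        ∀ n v w, L.Adj v w → SquareRel (fun n v w => ι (ρ n v w)) t n v w := by
  classical
  have := Fintype.ofFinite V
  suffices H : ∀ s : Finset V, ∃ (Ω : Type w) (ι : D →* Equiv.Perm Ω) (t : ℤ → V → Equiv.Perm Ω),
      Function.Injective ι ∧ ∀ n, ∀ v ∈ s, ∀ w ∈ s, L.Adj v w →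
        SquareRel (fun n v w => ι (ρ n v w)) t n v w by
    obtain ⟨Ω, ι, t, hι, h⟩ := H Finset.univ
    exact ⟨Ω, ι, t, hι, fun n v w => h n v (Finset.mem_univ _) w (Finset.mem_univ _)⟩
  intro s
  induction s using Finset.induction_on with
  | empty =>
    -- The regular representation; without vertices there are no relations.
    exact ⟨D, MulAction.toPermHom D D, fun _ _ => 1, MulAction.toPerm_injective, by simp⟩
  | insert u s hu ih =>
    obtain ⟨Ω, ι, t, hι, ht⟩ := ih
    -- The transport along the edge labelled `w`, read in the frame of the new vertex `u`.
    set σ : V → ℤ → Equiv.Perm Ω := fun w n => ι (ρ (n + 1) w u) * t n w * ι (ρ n u w) with hσ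
    set x : V → heightShiftSubgroup Ω := fun w =>
      if L.Adj u w then ⟨raisePerm (σ w), raisePerm_mem _⟩ else 1 with hx
    -- When both `v` and `w` are adjacent to `u`, the cocycle condition on the triangle `u`, `v`,
    -- `w` removes the holonomies from the old square relation, leaving commutation of the two
    -- raising permutations. If one of them is not adjacent to `u`, its factor is `1`.
    have hcomm : ∀ v ∈ s, ∀ w ∈ s, L.Adj v w → x v * x w = x w * x v := by
      intro v hv w hw hvw
      by_cases h1 : L.Adj u v
      · by_cases h2 : L.Adj u w
        · have key : ∀ n, σ v (n + 1) * σ w n = σ w (n + 1) * σ v n := by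
            intro n
            have h := ht n v hv w hw hvw
            simp only [SquareRel] at h
            have e1 : ι (ρ (n + 1) v w) = ι (ρ (n + 1) u w) * ι (ρ (n + 1) v u) := by
              rw [← map_mul, htri _ _ _ _ h1.symm h2 hvw]
            have e2 : ι (ρ (n + 1) w v) = ι (ρ (n + 1) u v) * ι (ρ (n + 1) w u) := by
              rw [← map_mul, htri _ _ _ _ h2.symm h1 hvw.symm]
            have e3 : ι (ρ (n + 2) v w) = ι (ρ (n + 2) w u)⁻¹ * ι (ρ (n + 2) v u) := by
              rw [← map_mul, ← hsymm _ _ _ h2.symm, htri _ _ _ _ h1.symm h2 hvw]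
            have e4 : ι (ρ n v w) = ι (ρ n u w) * ι (ρ n u v)⁻¹ := by
              rw [← map_mul, ← hsymm _ _ _ h1, htri _ _ _ _ h1.symm h2 hvw]
            rw [e1, e2, e3, e4] at h
            simp only [hσ]
            rw [show n + 1 + 1 = n + 2 by ring]
            simp only [map_inv] at h
            calc _ = ι (ρ (n + 2) w u) * ((ι (ρ (n + 2) w u))⁻¹ * ι (ρ (n + 2) v u) * t (n + 1) v *
                  (ι (ρ (n + 1) u v) * ι (ρ (n + 1) w u)) * t n w *
                  (ι (ρ n u w) * (ι (ρ n u v))⁻¹)) * ι (ρ n u v) := by group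
              _ = _ := by rw [← h]; group
          simp only [hx, if_pos h1, if_pos h2]
          refine Subtype.ext (Equiv.ext fun p => Prod.ext ?_ rfl)
          exact Equiv.congr_fun (key p.2) p.1
        · simp [hx, if_neg h2]
      · simp [hx, if_neg h1]
    set ι' : D →* Equiv.Perm (Ω × heightShiftSubgroup Ω) :=
      { toFun := fun d => (ι d).prodCongr 1
        map_one' := by ext p <;> simp
        map_mul' := fun a b => by ext p <;> simp } with hι'
    have ι'_apply : ∀ d ω a, ι' d (ω, a) = (ι d ω, a) := fun _ _ _ => rfl
    -- Old transports also move the slice parameter by `x v`; the new one preserves it and acts on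
    -- each slice by its own conjugate of the unit translation.
    set t' : ℤ → V → Equiv.Perm (Ω × heightShiftSubgroup Ω) := fun n v =>
      if v = u then slicePerm n else (t n v).prodCongr (Equiv.mulLeft (x v)) with ht'
    have t'_u : ∀ n, t' n u = slicePerm n := fun n => if_pos rfl
    have t'_apply : ∀ n, ∀ v ∈ s, ∀ ω a, t' n v (ω, a) = (t n v ω, x v * a) := by
      intro n v hv ω a
      have : v ≠ u := fun h => hu (h ▸ hv)
      simp only [ht', if_neg this]
      rfl
    have new : ∀ n, ∀ w ∈ s, L.Adj u w →
        SquareRel (fun n v w => ι' (ρ n v w)) t' n u w := by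
      intro n w hw h
      refine Equiv.ext ?_
      rintro ⟨ω, a⟩
      have hxw : x w = ⟨raisePerm (σ w), raisePerm_mem _⟩ := if_pos h
      have := slicePerm_raise (σ w) n ω a
      simp only [Equiv.Perm.mul_apply, t'_u]
      have e : slicePerm n (ω, a) = ((slicePerm n (ω, a)).1, a) := rfl
      rw [e]
      simp only [ι'_apply, t'_apply _ w hw]
      rw [show ι (ρ (n + 1) w u) (t n w (ι (ρ n u w) ω)) = σ w n ω from rfl, hxw, this]
      refine Prod.ext ?_ rfl
      simp only [hσ, Equiv.Perm.mul_apply]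
      rw [show n + 1 + 1 = n + 2 by ring, hsymm (n + 2) u w h, map_inv, Equiv.Perm.inv_def, Equiv.apply_symm_apply]
    refine ⟨Ω × heightShiftSubgroup Ω, ι', t', ?_, ?_⟩
    · intro a b hab
      refine hι (Equiv.ext fun ω => ?_)
      exact congrArg Prod.fst (Equiv.congr_fun hab (ω, 1))
    · intro n v hv w hw h
      rcases Finset.mem_insert.mp hv with rfl | hv'
      · rcases Finset.mem_insert.mp hw with rfl | hw'
        · exact absurd h (L.irrefl)
        · exact new n w hw' h
      · rcases Finset.mem_insert.mp hw with rfl | hw'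
        · exact (new n v hv' h.symm).symm fun m => by rw [hsymm m w v h.symm, map_inv]
        · refine Equiv.ext ?_
          rintro ⟨ω, a⟩
          simp only [Equiv.Perm.mul_apply, ι'_apply, t'_apply _ w hw', t'_apply _ v hv']
          refine Prod.ext (Equiv.congr_fun (ht n v hv' w hw' h) ω) ?_
          -- Old relations survive in the first coordinate; in the second they say that `x v` and `x
          -- w` commute.
          simp only [← mul_assoc, hcomm v hv' w hw' h]

/-! ### Deck transformations and the cocycle of a regular cover -/

/-- Unique path lifting: injectivity on neighbours spreads a fixed point along the edges of the
connected graph `M`. -/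
theorem coverDeckGroup_eq_one {V : Type u} {W : Type w} {L : SimpleGraph V} {M : SimpleGraph W}
    {f : M →g L} (hf : IsRegularCover f) {d : M ≃g M} (hd : d ∈ coverDeckGroup f) {x : W}
    (hx : d x = x) : d = 1 := by
  have key : ∀ {a b : W}, M.Walk a b → d a = a → d b = b := by
    intro a b p
    induction p with
    | nil => exact id
    | @cons a c b h p ih =>
      intro ha
      refine ih ((hf.bijOn_neighborSet a).injOn ?_ h (hd c))
      have := d.map_adj_iff.mpr h
      rwa [ha] at this
  refine RelIso.ext fun y => ?_
  obtain ⟨p⟩ := hf.connected.preconnected x y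
  exact key p hx

theorem coverDeckGroup_ext {V : Type u} {W : Type w} {L : SimpleGraph V} {M : SimpleGraph W}
    {f : M →g L} (hf : IsRegularCover f) {d d' : coverDeckGroup f} {x : W}
    (hx : d.1 x = d'.1 x) : d = d' := by
  have h : d'⁻¹ * d = 1 := Subtype.ext (coverDeckGroup_eq_one hf (d'⁻¹ * d).2 (x := x) (by
    change d'.1⁻¹ (d.1 x) = x
    rw [hx, ← RelIso.mul_apply, inv_mul_cancel, RelIso.one_apply]))
  exact (inv_mul_eq_one.mp h).symm

/-- A section of a regular cover over the vertices, with the cocycle of deck transformations that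
compares the frames given by the section at the two ends of an edge. -/
theorem IsRegularCover.exists_cocycle {V : Type u} {W : Type w} {L : SimpleGraph V}
    {M : SimpleGraph W} {f : M →g L} (hf : IsRegularCover f) :
    ∃ (s : V → W) (ρ : V → V → coverDeckGroup f), (∀ v, f (s v) = v) ∧
      (∀ v w, L.Adj v w → ρ w v = (ρ v w)⁻¹) ∧
      (∀ u v w, L.Adj u v → L.Adj v w → L.Adj u w → ρ v w * ρ u v = ρ u w) ∧
      ∀ (d d' : coverDeckGroup f) v w, M.Adj (d.1 (s v)) (d'.1 (s w)) → ρ v w = d'⁻¹ * d := by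
  classical
  choose s hs using hf.surjective
  have ex : ∀ v w, L.Adj v w → ∃ d : coverDeckGroup f, M.Adj (d.1 (s v)) (s w) := by
    intro v w h
    obtain ⟨b, hb, hbv⟩ := (hf.bijOn_neighborSet (s w)).surjOn
      (show v ∈ L.neighborSet (f (s w)) by rw [hs]; exact h.symm)
    obtain ⟨g, hg, hgb⟩ := hf.transitive (s v) b (by rw [hbv, hs])
    exact ⟨⟨g, hg⟩, by simpa only [hgb] using M.adj_symm hb⟩
  choose! ρ hρ using ex
  have uniq : ∀ (d d' : coverDeckGroup f) v w, M.Adj (d.1 (s v)) (d'.1 (s w)) →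
      ρ v w = d'⁻¹ * d := by
    intro d d' v w h
    have hL : L.Adj v w := by
      have := f.map_adj h
      rwa [d.2, d'.2, hs, hs] at this
    have h' : M.Adj ((d'⁻¹ * d).1 (s v)) (s w) := by
      have := (d'⁻¹).1.map_adj_iff.mpr h
      rwa [← RelIso.mul_apply, ← RelIso.mul_apply, ← Subgroup.coe_mul, ← Subgroup.coe_mul,
        inv_mul_cancel, Subgroup.coe_one, RelIso.one_apply] at this
    refine coverDeckGroup_ext hf (x := s v) ?_
    refine (hf.bijOn_neighborSet (s w)).injOn (hρ v w hL).symm h'.symm ?_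
    rw [(ρ v w).2, (d'⁻¹ * d).2]
  have adj : ∀ (d : coverDeckGroup f) v w, L.Adj v w →
      M.Adj ((d * ρ v w).1 (s v)) (d.1 (s w)) := by
    intro d v w h
    exact d.1.map_adj_iff.mpr (hρ v w h)
  refine ⟨s, ρ, hs, ?_, ?_, uniq⟩
  · intro v w h
    have := uniq 1 (ρ v w) w v (hρ v w h).symm
    rwa [mul_one] at this
  · intro u v w huv hvw huw
    have h1 := adj (ρ v w) u v huv
    have h2 := hρ v w hvw
    -- Triangles lift to triangles, so the lifts of the two outer vertices are adjacent; this is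
    -- what makes `ρ` multiplicative.
    have h3 := hf.adj_of_adj _ _ _ h1.symm h2 (by
      rw [(ρ v w * ρ u v).2, hs, hs]; exact huw)
    have := uniq _ 1 u w h3
    rw [inv_one, one_mul] at this
    exact this.symm

/-! ### Holonomy and the transport functor -/

/-- The holonomy of `ρ` along a list of vertices. -/
def listHolonomy {V : Type*} {G : Type*} [Group G] (ρ : V → V → G) : List V → G
  | [] => 1
  | [_] => 1
  | v :: w :: l => listHolonomy ρ (w :: l) * ρ v w

theorem listHolonomy_cons_support {V X : Type*} {G : Type*} [Group G] (ρ : V → V → G)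
    {H : SimpleGraph X} (φ : X → V) (z : V) {x y : X} (p : H.Walk x y) :
    listHolonomy ρ (z :: p.support.map φ) = listHolonomy ρ (p.support.map φ) * ρ z (φ x) := by
  rw [← p.cons_tail_support]
  rfl

theorem listHolonomy_map {V : Type*} {G G' : Type*} [Group G] [Group G'] (ι : G →* G')
    (ρ : V → V → G) : ∀ l : List V,
      listHolonomy (fun v w => ι (ρ v w)) l = ι (listHolonomy ρ l)
  | [] => (map_one ι).symm
  | [_] => (map_one ι).symm
  | v :: w :: l => by
    rw [listHolonomy, listHolonomy, map_mul, listHolonomy_map ι ρ (w :: l)]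

theorem listHolonomy_one {V : Type*} {G : Type*} [Group G] : ∀ l : List V,
    listHolonomy (fun _ _ => (1 : G)) l = 1
  | [] => rfl
  | [_] => rfl
  | v :: w :: l => by
    rw [listHolonomy, listHolonomy_one (w :: l), mul_one]

/-- Each edge of the walk contributes the quotient of the deck transformations that carry the
section to its two ends, and the product telescopes. -/
theorem listHolonomy_of_walk {V : Type u} {W : Type w} {L : SimpleGraph V} {M : SimpleGraph W}
    {f : M →g L} {s : V → W} {ρ : V → V → coverDeckGroup f}
    (hf : IsRegularCover f) (hs : ∀ v, f (s v) = v)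
    (hρ : ∀ (d d' : coverDeckGroup f) v w, M.Adj (d.1 (s v)) (d'.1 (s w)) → ρ v w = d'⁻¹ * d)
    {a b : W} (q : M.Walk a b) : ∀ d d' : coverDeckGroup f, d.1 (s (f a)) = a →
      d'.1 (s (f b)) = b → listHolonomy ρ (q.support.map f) = d'⁻¹ * d := by
  induction q with
  | nil =>
    intro d d' h h'
    rw [coverDeckGroup_ext hf (h.trans h'.symm), inv_mul_cancel]
    rfl
  | @cons a c b h q ih =>
    intro d d' hd hd'
    obtain ⟨g, hg, hgc⟩ := hf.transitive (s (f c)) c (hs _)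
    rw [SimpleGraph.Walk.support_cons, List.map_cons, listHolonomy_cons_support,
      ih ⟨g, hg⟩ d' hgc hd', hρ d ⟨g, hg⟩ _ _ (by rw [hd]; simpa only [hgc] using h)]
    group

/-- Moving from the bottom of an edge to its end `x.2`. -/
def endTransport {V : Type u} {L : SimpleGraph V} {G : Type*} [Group G] (t : ℤ → V → G)
    (x : BBEdge L × Bool) : G :=
  if x.2 then t x.1.bot x.1.label else 1

/-- The functor on paths given by transports along edges and holonomies at corners. -/
def transportFunctor {V : Type u} (L : SimpleGraph V) {G : Type*} [Group G]
    (ρ : ℤ → V → V → G) (t : ℤ → V → G) :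
    CategoryTheory.Functor (CategoryTheory.Paths (BBEdge L)) (CategoryTheory.SingleObj G) :=
  CategoryTheory.Paths.lift
    { obj := fun _ => CategoryTheory.SingleObj.star G
      map := fun {e e'} c => (endTransport t (e', Corner.t c))⁻¹ *
        ρ (e.endpoint (Corner.s c)) e.label e'.label * endTransport t (e, Corner.s c) }

theorem transportFunctor_corner_comp {V : Type u} {L : SimpleGraph V} {G : Type*} [Group G]
    (ρ : ℤ → V → V → G) (t : ℤ → V → G) {e e' e'' : BBEdge L} (p : Quiver.Path e e')
    (c : Corner e' e'') :
    (transportFunctor L ρ t).map (p.comp c.toPath) =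
      ((endTransport t (e'', c.t))⁻¹ * ρ (e'.endpoint c.s) e'.label e''.label *
        endTransport t (e', c.s) : G) * ((transportFunctor L ρ t).map p : G) :=
  rfl

theorem transportFunctor_corner {V : Type u} {L : SimpleGraph V} {G : Type*} [Group G]
    (ρ : ℤ → V → V → G) (t : ℤ → V → G) {e e' : BBEdge L} (c : Corner e e') :
    (transportFunctor L ρ t).map c.toPath =
      ((endTransport t (e', c.t))⁻¹ * ρ (e.endpoint c.s) e.label e'.label *
        endTransport t (e, c.s) : G) :=
  CategoryTheory.Paths.lift_toPath _ _

/-- The transports at intermediate ends cancel. For a loop the value is therefore a conjugate of the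
holonomy, which reduces the branching relations to statements about `ρ n`. -/
theorem transportFunctor_linkPath {V : Type u} {L : SimpleGraph V} {G : Type*} [Group G]
    (ρ : ℤ → V → V → G) (t : ℤ → V → G) {n : ℤ}
    {x y : {x : BBEdge L × Bool // x.1.endpoint x.2 = n}} (p : (bbLink L n).Walk x y) :
    (transportFunctor L ρ t).map (bbLinkPath p) =
      ((endTransport t y.1)⁻¹ * listHolonomy (ρ n) (p.support.map fun y => y.1.1.label) *
        endTransport t x.1 : G) := by
  induction p with
  | nil =>
    simp only [SimpleGraph.Walk.support_nil, List.map_cons, List.map_nil, listHolonomy, mul_one,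
      inv_mul_cancel]
    exact (transportFunctor L ρ t).map_id _
  | @cons x z y h p ih =>
    rw [SimpleGraph.Walk.support_cons, List.map_cons, listHolonomy_cons_support]
    refine ((transportFunctor L ρ t).map_comp (Corner.toPath _) (bbLinkPath p)).trans ?_
    rw [CategoryTheory.SingleObj.comp_as_mul, transportFunctor_corner, ih]
    simp only [x.2]
    group

theorem transportFunctor_square {V : Type u} {L : SimpleGraph V} {G : Type*} [Group G]
    {ρ : ℤ → V → V → G} {t : ℤ → V → G} {n : ℤ} {v w : V} (h : L.Adj v w)
    (hρ : ρ (n + 1) w v = (ρ (n + 1) v w)⁻¹) (ht : SquareRel ρ t n v w) :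
    (transportFunctor L ρ t).map (bbSquarePath n h) = (1 : G) := by
  simp only [bbSquarePath]
  rw [transportFunctor_corner_comp, transportFunctor_corner_comp, transportFunctor_corner_comp,
    transportFunctor_corner]
  simp only [endTransport, BBEdge.endpoint]
  simp only [SquareRel] at ht
  rw [show n + 1 + 1 = n + 2 by ring]
  simp only [if_true, Bool.false_eq_true, if_false, inv_one, one_mul, mul_one]
  calc _ = (t n v)⁻¹ * ρ (n + 1) w v * (t (n + 1) w)⁻¹ * (ρ (n + 2) v w * t (n + 1) v *
        ρ (n + 1) w v * t n w * ρ n v w) := by group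
    _ = _ := by rw [← ht, hρ]; group

/-! ### Nontriviality of the branching -/

/-- The inclusion of `L` in the link of the vertex `n` as the ascending link. -/
def ascendingLink {V : Type u} (L : SimpleGraph V) (n : ℤ) : L →g bbLink L n where
  toFun v := ⟨(⟨n, v⟩, false), rfl⟩
  map_rel' h := h

/-- The class of the path in the ascending link of the vertex `n` given by a path in `L`. -/
def ascendingClass {V : Type u} {W : Type w} {L : SimpleGraph V} {M : SimpleGraph W}
    (f : M →g L) (S : Set ℤ) (n : ℤ) {v w : V} (γ : L.Walk v w) :
    (⟨(⟨n, v⟩ : BBEdge L)⟩ : BranchGroupoid f S) ⟶ ⟨(⟨n, w⟩ : BBEdge L)⟩ :=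
  (CategoryTheory.Quotient.functor (BranchRel f S)).map (bbLinkPath (γ.map (ascendingLink L n)))

/-- The branching is not trivial: a loop in the ascending link of a branching vertex that lifts to
a path in `M` with different endpoints is not trivial. -/
theorem ascendingClass_ne_id {V : Type u} [Finite V] {W : Type w} {L : SimpleGraph V}
    {M : SimpleGraph W} {f : M →g L} (hf : IsRegularCover f) {S : Set ℤ} {n : ℤ} (hn : n ∉ S)
    {v : V} (γ : L.Walk v v) {a b : W} (hab : a ≠ b) (q : M.Walk a b)
    (hq : q.support.map f = γ.support) :
    ascendingClass f S n γ ≠ CategoryTheory.CategoryStruct.id _ := by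
  classical
  obtain ⟨s, ρ, hs, hsymm, htri, hρ⟩ := hf.exists_cocycle
  -- Switching the cocycle off at heights in `S` kills all link loops there; elsewhere it kills
  -- those that lift to closed paths.
  set r : ℤ → V → V → coverDeckGroup f := fun n v w => if n ∈ S then 1 else ρ v w with hr
  have r_mem : ∀ n ∈ S, r n = fun _ _ => 1 := fun n h => by simp [hr, h]
  have r_not_mem : ∀ n ∉ S, r n = ρ := fun n h => by simp [hr, h]
  have rsymm : ∀ n v w, L.Adj v w → r n w v = (r n v w)⁻¹ := by
    intro n v w h
    by_cases hnS : n ∈ S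
    · simp [r_mem n hnS]
    · simp [r_not_mem n hnS, hsymm v w h]
  obtain ⟨Ω, ι, t, hι, ht⟩ := exists_square_action L r rsymm (by
    intro n u v w h1 h2 h3
    by_cases hnS : n ∈ S
    · simp [r_mem n hnS]
    · simp [r_not_mem n hnS, htri u v w h1 h2 h3])
  set F := transportFunctor L (fun n v w => ι (r n v w)) t with hF
  have hrel : ∀ (x y : CategoryTheory.Paths (BBEdge L)) (p q : x ⟶ y), BranchRel f S p q →
      F.map p = F.map q := by
    rintro x y _ _ (⟨m, h⟩ | ⟨m, hm, p⟩ | ⟨m, hm, p, a, q, hq⟩)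
    · exact (transportFunctor_square h (by simp only [rsymm _ _ _ h, map_inv])
        (ht m _ _ h)).trans (F.map_id _).symm
    · refine ((transportFunctor_linkPath _ _ p).trans ?_).trans (F.map_id _).symm
      simp only [r_mem m hm, listHolonomy_one, map_one, mul_one, inv_mul_cancel]
      rfl
    · refine ((transportFunctor_linkPath _ _ p).trans ?_).trans (F.map_id _).symm
      obtain ⟨g, hg, hga⟩ := hf.transitive (s (f a)) a (hs _)
      rw [← hq]
      simp only [r_not_mem m hm]
      rw [listHolonomy_map, listHolonomy_of_walk hf hs hρ q ⟨g, hg⟩ ⟨g, hg⟩ hga hga]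
      simp only [inv_mul_cancel, map_one, mul_one]
      rfl
  intro hid
  have h1 : F.map (bbLinkPath (γ.map (ascendingLink L n))) = F.map Quiver.Path.nil :=
    congrArg (CategoryTheory.Quotient.lift _ F hrel).map hid
  have h2 := (transportFunctor_linkPath (fun n v w => ι (r n v w)) t
    (γ.map (ascendingLink L n))).symm.trans (h1.trans (F.map_id _))
  have h3 : ((γ.map (ascendingLink L n)).support.map fun y => y.1.1.label) = γ.support := by
    rw [SimpleGraph.Walk.support_map, List.map_map]
    exact List.map_id _
  obtain ⟨g, hg, hga⟩ := hf.transitive (s (f a)) a (hs _)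
  obtain ⟨g', hg', hgb⟩ := hf.transitive (s (f b)) b (hs _)
  have ha : f a = v := by
    have := congrArg List.head? hq
    rw [← q.cons_tail_support, ← γ.cons_tail_support] at this
    exact Option.some.inj this
  have hb : f b = v := by
    have := congrArg List.getLast? hq
    rw [List.getLast?_map, List.getLast?_eq_some_getLast q.support_ne_nil,
      List.getLast?_eq_some_getLast γ.support_ne_nil] at this
    simpa using this
  rw [h3] at h2
  simp only [r_not_mem n hn] at h2
  rw [← hq, listHolonomy_map, listHolonomy_of_walk hf hs hρ q ⟨g, hg⟩ ⟨g', hg'⟩ hga hgb] at h2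
  have h4 : ι ((⟨g', hg'⟩ : coverDeckGroup f)⁻¹ * ⟨g, hg⟩) = 1 := by
    have h5 : (1 : Equiv.Perm Ω)⁻¹ * ι ((⟨g', hg'⟩ : coverDeckGroup f)⁻¹ * ⟨g, hg⟩) * 1 = 1 := h2
    rwa [inv_one, one_mul, mul_one] at h5
  -- Faithfulness of `ι` turns trivial holonomy into equality of the deck transformations at the two
  -- ends of `q`, contradicting `a ≠ b`.
  have h5 := inv_mul_eq_one.mp (hι (h4.trans (map_one ι).symm))
  refine hab ?_
  rw [← hga, ← hgb, ha, hb]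
  exact congrArg (fun d : coverDeckGroup f => d.1 (s v)) h5.symm

/-! ### The path classes form a connected groupoid -/

open CategoryTheory in
theorem linkPath_eq_id {V : Type u} {W : Type w} {L : SimpleGraph V} {M : SimpleGraph W}
    {f : M →g L} {S : Set ℤ} {n : ℤ} {x : {x : BBEdge L × Bool // x.1.endpoint x.2 = n}}
    (p : (bbLink L n).Walk x x) (hp : LiftsToLoop f p) :
    (Quotient.functor (BranchRel f S)).map (bbLinkPath p) = 𝟙 _ := by
  by_cases hn : n ∈ S
  · exact CategoryTheory.Quotient.sound _ (.unbranched n hn p)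
  · exact CategoryTheory.Quotient.sound _ (.branched n hn p hp)

theorem bbLinkPath_append {V : Type u} {L : SimpleGraph V} {n : ℤ}
    {x y z : {x : BBEdge L × Bool // x.1.endpoint x.2 = n}} (p : (bbLink L n).Walk x y)
    (q : (bbLink L n).Walk y z) :
    bbLinkPath (p.append q) = (bbLinkPath p).comp (bbLinkPath q) := by
  induction p with
  | nil => exact (Quiver.Path.nil_comp _).symm
  | cons h p ih =>
    rw [SimpleGraph.Walk.cons_append, bbLinkPath, bbLinkPath, ih, Quiver.Path.comp_assoc]

open CategoryTheory in
theorem ascendingClass_append {V : Type u} {W : Type w} {L : SimpleGraph V} {M : SimpleGraph W}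
    (f : M →g L) (S : Set ℤ) (n : ℤ) {v w z : V} (γ : L.Walk v w) (δ : L.Walk w z) :
    ascendingClass f S n (γ.append δ) = ascendingClass f S n γ ≫ ascendingClass f S n δ := by
  unfold ascendingClass
  rw [SimpleGraph.Walk.map_append, bbLinkPath_append]
  exact (Quotient.functor (BranchRel f S)).map_comp _ _

theorem IsRegularCover.exists_adj_lift {V : Type u} {W : Type w} {L : SimpleGraph V}
    {M : SimpleGraph W} {f : M →g L} (hf : IsRegularCover f) {a : W} {v w : V} (ha : f a = v)
    (h : L.Adj v w) : ∃ b, M.Adj a b ∧ f b = w :=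
  (hf.bijOn_neighborSet a).surjOn (show w ∈ L.neighborSet (f a) by rw [ha]; exact h)

/-- A step and its reverse in `L` lift to a step and its reverse in `M`. The ends `x` and `z` may
differ in the link, one ascending and one descending; only their labels must agree. Quantifying over
all lifts `a` lets backtracks be nested. -/
theorem liftsToLoop_backtrack {V : Type u} {W : Type w} {L : SimpleGraph V} {M : SimpleGraph W}
    {f : M →g L} (hf : IsRegularCover f) {n : ℤ}
    {x y z : {x : BBEdge L × Bool // x.1.endpoint x.2 = n}} (h : (bbLink L n).Adj x y)
    (h' : (bbLink L n).Adj y z) (hz : x.1.1.label = z.1.1.label) :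
    ∀ (p : (bbLink L n).Walk z x), (∀ a, f a = z.1.1.label → ∃ q : M.Walk a a,
      q.support.map f = p.support.map fun y => y.1.1.label) →
      ∀ a, f a = x.1.1.label → ∃ q : M.Walk a a, q.support.map f =
        ((p.cons h').cons h).support.map fun y => y.1.1.label := by
  intro p hp a ha
  obtain ⟨b, hab, hb⟩ := hf.exists_adj_lift ha h
  obtain ⟨q, hq⟩ := hp a (ha.trans hz)
  refine ⟨(q.cons hab.symm).cons hab, ?_⟩
  simp only [SimpleGraph.Walk.support_cons, List.map_cons, hq, ha, hb]

theorem liftsToLoop_two {V : Type u} {W : Type w} {L : SimpleGraph V} {M : SimpleGraph W}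
    {f : M →g L} (hf : IsRegularCover f) {n : ℤ}
    {x y : {x : BBEdge L × Bool // x.1.endpoint x.2 = n}} (h : (bbLink L n).Adj x y) :
    LiftsToLoop f (.cons h (.cons h.symm .nil) : (bbLink L n).Walk x x) := by
  obtain ⟨a, ha⟩ := hf.surjective x.1.1.label
  exact ⟨a, liftsToLoop_backtrack hf h h.symm rfl _ (fun a ha => ⟨.nil, by simp [ha]⟩) a ha⟩

/-- The projection to `L` is two successive backtracks from the same vertex. These 4-cycles tie the
descending part of a link to the ascending part. -/
theorem liftsToLoop_four {V : Type u} {W : Type w} {L : SimpleGraph V} {M : SimpleGraph W}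
    {f : M →g L} (hf : IsRegularCover f) {n : ℤ}
    {x y x' y' : {x : BBEdge L × Bool // x.1.endpoint x.2 = n}} (h₁ : (bbLink L n).Adj x y)
    (h₂ : (bbLink L n).Adj y x') (h₃ : (bbLink L n).Adj x' y') (h₄ : (bbLink L n).Adj y' x)
    (hx : x.1.1.label = x'.1.1.label) :
    LiftsToLoop f (.cons h₁ (.cons h₂ (.cons h₃ (.cons h₄ .nil))) : (bbLink L n).Walk x x) := by
  obtain ⟨a, ha⟩ := hf.surjective x.1.1.label
  exact ⟨a, liftsToLoop_backtrack hf h₁ h₂ hx _ (fun a ha => by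
    obtain ⟨b, hab, hb⟩ := hf.exists_adj_lift ha h₃
    exact ⟨.cons hab (.cons hab.symm .nil), by simp [ha, hb, hx]⟩) a ha⟩

open CategoryTheory in
/-- The class of the path across a corner. -/
def cornerClass {V : Type u} {W : Type w} {L : SimpleGraph V} {M : SimpleGraph W} (f : M →g L)
    (S : Set ℤ) {e e' : BBEdge L} (c : Corner e e') :
    (⟨e⟩ : BranchGroupoid f S) ⟶ ⟨e'⟩ :=
  (Quotient.functor (BranchRel f S)).map c.toPath

/-- The corner at the vertex `n` given by an edge of the link. -/
def linkCorner {V : Type u} {L : SimpleGraph V} {n : ℤ}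
    {x y : {x : BBEdge L × Bool // x.1.endpoint x.2 = n}} (h : L.Adj x.1.1.label y.1.1.label) :
    Corner x.1.1 y.1.1 :=
  ⟨x.1.2, y.1.2, x.2.trans y.2.symm, h⟩

open CategoryTheory in
theorem linkCorner_comp_symm {V : Type u} {W : Type w} {L : SimpleGraph V} {M : SimpleGraph W}
    {f : M →g L} (hf : IsRegularCover f) (S : Set ℤ) {n : ℤ}
    {x y : {x : BBEdge L × Bool // x.1.endpoint x.2 = n}} (h : L.Adj x.1.1.label y.1.1.label) :
    cornerClass f S (linkCorner h) ≫ cornerClass f S (linkCorner h.symm) = 𝟙 _ :=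
  linkPath_eq_id _ (liftsToLoop_two hf (n := n) (x := x) (y := y) h)

open CategoryTheory in
theorem isIso_cornerClass {V : Type u} {W : Type w} {L : SimpleGraph V} {M : SimpleGraph W}
    {f : M →g L} (hf : IsRegularCover f) (S : Set ℤ) {e e' : BBEdge L} (c : Corner e e') :
    IsIso (cornerClass f S c) :=
  let x : {x : BBEdge L × Bool // x.1.endpoint x.2 = e.endpoint c.s} := ⟨(e, c.s), rfl⟩
  let y : {x : BBEdge L × Bool // x.1.endpoint x.2 = e.endpoint c.s} := ⟨(e', c.t), c.meet.symm⟩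
  ⟨cornerClass f S (linkCorner (x := y) (y := x) c.adj.symm),
    linkCorner_comp_symm hf S (x := x) (y := y) c.adj,
    linkCorner_comp_symm hf S (x := y) (y := x) c.adj.symm⟩

open CategoryTheory in
theorem BranchGroupoid.isIso {V : Type u} {W : Type w} {L : SimpleGraph V} {M : SimpleGraph W}
    {f : M →g L} (hf : IsRegularCover f) {S : Set ℤ} {x y : BranchGroupoid f S} (m : x ⟶ y) :
    IsIso m := by
  suffices H : ∀ {e e' : BBEdge L} (p : Quiver.Path e e'),
      IsIso ((Quotient.functor (BranchRel f S)).map p) by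
    obtain ⟨p⟩ := m
    exact H p
  intro e e' p
  induction p with
  | nil => exact (inferInstance : IsIso (𝟙 (⟨e⟩ : BranchGroupoid f S)))
  | cons p c ih =>
    have h1 := isIso_cornerClass hf S c
    have h2 := ih
    have h3 : (Quotient.functor (BranchRel f S)).map (p.cons c) =
        (Quotient.functor (BranchRel f S)).map p ≫ cornerClass f S c :=
      (Quotient.functor (BranchRel f S)).map_comp p (Corner.toPath c)
    rw [h3]
    infer_instance

open CategoryTheory in
theorem BranchGroupoid.nonempty_iso {V : Type u} {W : Type w} {L : SimpleGraph V}
    {M : SimpleGraph W} (hL : L.Connected) {f : M →g L} (hf : IsRegularCover f) (S : Set ℤ)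
    (hV : ∀ v, ∃ w, L.Adj v w) (x y : BranchGroupoid f S) : Nonempty (x ≅ y) := by
  have of_hom : ∀ {x y : BranchGroupoid f S}, (x ⟶ y) → Nonempty (x ≅ y) := fun m =>
    have := BranchGroupoid.isIso hf m
    ⟨asIso m⟩
  have horizontal : ∀ n v w, Nonempty
      ((⟨(⟨n, v⟩ : BBEdge L)⟩ : BranchGroupoid f S) ≅ ⟨(⟨n, w⟩ : BBEdge L)⟩) := by
    intro n v w
    obtain ⟨p⟩ := hL.preconnected v w
    exact of_hom (ascendingClass f S n p)
  obtain ⟨v₀⟩ := hL.nonempty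
  have up : ∀ n, Nonempty
      ((⟨(⟨n, v₀⟩ : BBEdge L)⟩ : BranchGroupoid f S) ≅ ⟨(⟨n + 1, v₀⟩ : BBEdge L)⟩) := by
    -- A neighbour `w` of `v₀` is needed to climb: the two edges labelled `v₀` that meet at height
    -- `n + 1` span no square with each other.
    intro n
    obtain ⟨w, hw⟩ := hV v₀
    obtain ⟨i⟩ := horizontal (n + 1) w v₀
    exact of_hom (cornerClass f S
      (⟨true, false, rfl, hw⟩ : Corner (⟨n, v₀⟩ : BBEdge L) ⟨n + 1, w⟩) ≫ i.hom)
  have base : ∀ n, Nonempty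
      ((⟨(⟨0, v₀⟩ : BBEdge L)⟩ : BranchGroupoid f S) ≅ ⟨(⟨n, v₀⟩ : BBEdge L)⟩) := by
    intro n
    induction n using Int.induction_on with
    | zero => exact ⟨Iso.refl _⟩
    | succ n ih =>
      obtain ⟨i⟩ := ih
      obtain ⟨j⟩ := up n
      exact ⟨i ≪≫ j⟩
    | pred n ih =>
      obtain ⟨i⟩ := ih
      obtain ⟨j⟩ := up (-n - 1)
      rw [sub_add_cancel] at j
      exact ⟨i ≪≫ j.symm⟩
  obtain ⟨⟨n, v⟩⟩ := x
  obtain ⟨⟨m, w⟩⟩ := y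
  obtain ⟨i⟩ := base n
  obtain ⟨j⟩ := base m
  obtain ⟨i'⟩ := horizontal n v₀ v
  obtain ⟨j'⟩ := horizontal m v₀ w
  exact ⟨(i ≪≫ i').symm ≪≫ j ≪≫ j'⟩

open CategoryTheory in
theorem inv_comp_eq_iff {C : Type*} [Category* C] {x y z : C} (g : x ≅ x) (p : x ⟶ y) (q : x ⟶ z)
    (c : y ⟶ z) : g.inv ≫ q = (g.inv ≫ p) ≫ c ↔ q = p ≫ c := by
  rw [Category.assoc, cancel_epi]

/-! ### Automorphisms of the base edge as deck transformations -/

namespace BranchGroupoid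

open CategoryTheory

variable {V : Type u} {W : Type w} {L : SimpleGraph V} {M : SimpleGraph W} {f : M →g L}
  {S : Set ℤ} {e₀ : BBEdge L}

/-- The action of the automorphisms of the base edge on the edges of `X_L^M(S)`. -/
def edgeAct (g : Aut (⟨e₀⟩ : BranchGroupoid f S)) (p : XEdge f S e₀) : XEdge f S e₀ :=
  -- Multiplication in `Aut` reverses composition, so precomposing with the inverse gives a left
  -- action.
  ⟨p.edge, g.inv ≫ p.path⟩

theorem edgeAct_one (p : XEdge f S e₀) : edgeAct 1 p = p := by
  change (⟨p.edge, 𝟙 _ ≫ p.path⟩ : XEdge f S e₀) = p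
  rw [Category.id_comp]

theorem edgeAct_mul (g h : Aut (⟨e₀⟩ : BranchGroupoid f S)) (p : XEdge f S e₀) :
    edgeAct (g * h) p = edgeAct g (edgeAct h p) := by
  change (⟨p.edge, (g.inv ≫ h.inv) ≫ p.path⟩ : XEdge f S e₀) = ⟨p.edge, g.inv ≫ h.inv ≫ p.path⟩
  rw [Category.assoc]

theorem XCorner_edgeAct (g : Aut (⟨e₀⟩ : BranchGroupoid f S)) (p : XEdge f S e₀) (s : Bool)
    (q : XEdge f S e₀) (t : Bool) :
    XCorner (edgeAct g p) s (edgeAct g q) t ↔ XCorner p s q t := by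
  refine exists_congr fun c => and_congr Iff.rfl (and_congr Iff.rfl ?_)
  exact inv_comp_eq_iff g p.path q.path _

/-- The action of the automorphisms of the base edge on the vertices of `X_L^M(S)`. -/
def vertexAct (g : Aut (⟨e₀⟩ : BranchGroupoid f S)) : XVertex f S e₀ → XVertex f S e₀ :=
  Quot.map (fun x => (edgeAct g x.1, x.2)) fun _ _ h => (XCorner_edgeAct g _ _ _ _).mpr h

theorem vertexAct_one (x : XVertex f S e₀) : vertexAct 1 x = x := by
  obtain ⟨p, s⟩ := x
  exact congrArg (fun p => Quot.mk _ (p, s)) (edgeAct_one p)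

theorem vertexAct_mul (g h : Aut (⟨e₀⟩ : BranchGroupoid f S)) (x : XVertex f S e₀) :
    vertexAct (g * h) x = vertexAct g (vertexAct h x) := by
  obtain ⟨p, s⟩ := x
  exact congrArg (fun p => Quot.mk _ (p, s)) (edgeAct_mul g h p)

/-- The automorphisms of the base edge as deck transformations of `X_L^M(S)`. -/
def toDeck : Aut (⟨e₀⟩ : BranchGroupoid f S) →* GenBestvinaBrady f S e₀ :=
  let _edgeAction : MulAction (Aut (⟨e₀⟩ : BranchGroupoid f S)) (XEdge f S e₀) :=
    { smul := edgeAct, one_smul := edgeAct_one, mul_smul := edgeAct_mul }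
  let _vertexAction : MulAction (Aut (⟨e₀⟩ : BranchGroupoid f S)) (XVertex f S e₀) :=
    { smul := vertexAct, one_smul := vertexAct_one, mul_smul := vertexAct_mul }
  ((MulAction.toPermHom _ (XVertex f S e₀)).prod (MulAction.toPermHom _ (XEdge f S e₀))).codRestrict
    (GenBestvinaBrady f S e₀) fun g => ⟨fun _ => rfl, fun _ _ => rfl, XCorner_edgeAct g⟩

/-- An automorphism is recovered from the image of the base edge with its identity path. Injectivity
suffices, since virtual torsion-freeness passes to subgroups. -/
theorem toDeck_injective : Function.Injective
    (toDeck : Aut (⟨e₀⟩ : BranchGroupoid f S) →* GenBestvinaBrady f S e₀) := by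
  intro g h hgh
  have h1 : edgeAct g ⟨e₀, 𝟙 _⟩ = edgeAct h ⟨e₀, 𝟙 _⟩ :=
    congrArg (fun k : GenBestvinaBrady f S e₀ => k.1.2 ⟨e₀, 𝟙 _⟩) hgh
  simp only [edgeAct, XEdge.mk.injEq, heq_eq_eq, true_and, Category.comp_id] at h1
  exact Iso.ext_inv h1

end BranchGroupoid

/-! ### Passage to a finite quotient -/

theorem IsVirtuallyTorsionFree.of_injective {G H : Type*} [Group G] [Group H] (φ : G →* H)
    (hφ : Function.Injective φ) (h : IsVirtuallyTorsionFree H) : IsVirtuallyTorsionFree G := by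
  obtain ⟨K, hK, hK'⟩ := h
  refine ⟨K.comap φ, ⟨by
    rw [Subgroup.index_comap]
    exact (Subgroup.instFiniteIndex_subgroupOf K φ.range).index_ne_zero⟩, fun g hg ho => hφ ?_⟩
  rw [map_one]
  exact hK' _ hg (φ.isOfFinOrder ho)

open CategoryTheory in
/-- In a connected groupoid with a virtually torsion-free automorphism group, a functor to
a finite group is not trivial on any nontrivial endomorphism of finite order. -/
theorem exists_functor_finite_group {C : Type*} [Category.{u} C]
    (hC : ∀ {x y : C} (m : x ⟶ y), IsIso m) (hconn : ∀ x y : C, Nonempty (x ≅ y)) (x₀ : C)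
    (h : IsVirtuallyTorsionFree (Aut x₀)) :
    ∃ (Q : Type u) (_ : Group Q) (_ : Finite Q) (Φ : C ⥤ SingleObj Q),
      ∀ (x : C) (m : x ⟶ x), IsOfFinOrder (G := End x) m → Φ.map m = (1 : Q) → m = 𝟙 x := by
  obtain ⟨H, hH, hH'⟩ := h
  let r : ∀ x : C, x₀ ≅ x := fun x => (hconn x₀ x).some
  -- Chosen isomorphisms from `x₀` close every morphism up to a loop at `x₀`, retracting the
  -- groupoid onto `Aut x₀`.
  let loop : ∀ {x y : C}, (x ⟶ y) → Aut x₀ := fun {x y} m =>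
    have := hC m
    r x ≪≫ asIso m ≪≫ (r y).symm
  have loop_id : ∀ x : C, loop (𝟙 x) = 1 := fun x => Iso.ext (by
    change (r x).hom ≫ 𝟙 x ≫ (r x).inv = 𝟙 x₀
    simp)
  have loop_comp : ∀ {x y z : C} (m : x ⟶ y) (m' : y ⟶ z), loop (m ≫ m') = loop m' * loop m :=
    fun {x y z} m m' => Iso.ext (by
      change (r x).hom ≫ (m ≫ m') ≫ (r z).inv =
        ((r x).hom ≫ m ≫ (r y).inv) ≫ (r y).hom ≫ m' ≫ (r z).inv
      simp)
  -- The normal core still has finite index and, lying inside `H`, has no torsion.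
  refine ⟨Aut x₀ ⧸ H.normalCore, inferInstance, inferInstance,
    { obj := fun _ => SingleObj.star _
      map := fun m => (loop m : Aut x₀ ⧸ H.normalCore)
      map_id := fun x => ?_
      map_comp := fun {x y z} m m' => ?_ }, fun x m hm h1 => ?_⟩
  · rw [loop_id]
    rfl
  · rw [loop_comp]
    rfl
  · have h2 : loop m ∈ H := H.normalCore_le ((QuotientGroup.eq_one_iff _).mp h1)
    have h3 : loop m = 1 := by
      refine hH' _ h2 ?_
      let ψ : End x →* Aut x₀ :=
        { toFun := fun m => loop (x := x) (y := x) m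
          map_one' := loop_id x
          map_mul' := fun a b => loop_comp (x := x) (y := x) (z := x) b a }
      exact ψ.isOfFinOrder hm
    have h5 : (r x).hom ≫ m ≫ (r x).inv = 𝟙 x₀ := congrArg Iso.hom h3
    rw [← cancel_epi (r x).hom, ← cancel_mono (r x).inv]
    simpa using h5

/-! ### Periodicity up to conjugation in a finite group -/

/-- A sequence in a group of exponent `N` that satisfies the recursion
`D (k + 2) = D (k + 1) * (D k)⁻¹ * D (k + 1)` has period `N`. -/
theorem apply_exponent_of_recursion {Q : Type*} [Group Q] {N : ℕ} (hN : ∀ q : Q, q ^ N = 1)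
    (D : ℕ → Q) (hD : ∀ k, D (k + 2) = D (k + 1) * (D k)⁻¹ * D (k + 1)) : D N = D 0 := by
  -- The recursion says that successive quotients agree, so `D` is a geometric progression.
  have h1 : ∀ k, (D k)⁻¹ * D (k + 1) = (D 0)⁻¹ * D 1 := by
    intro k
    induction k with
    | zero => rfl
    | succ k ih =>
      rw [hD, ← ih]
      group
  have h2 : ∀ k, D k = D 0 * ((D 0)⁻¹ * D 1) ^ k := by
    intro k
    induction k with
    | zero => simp
    | succ k ih => rw [pow_succ, ← mul_assoc, ← ih, ← h1 k, mul_inv_cancel_left]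
  rw [h2 N, hN, mul_one]

/-- In a group of exponent `N`, a solution of the square equations is periodic with period `N` up
to a gauge transformation. -/
theorem exists_gauge_add_exponent {V Q : Type*} [Group Q] {N : ℕ} (hN : ∀ q : Q, q ^ N = 1)
    (L : SimpleGraph V) (c : ℤ → V → V → Q) (τ : ℤ → V → Q)
    (hc : ∀ n v w, L.Adj v w → c n w v = (c n v w)⁻¹)
    (hsq : ∀ n v w, L.Adj v w → (τ n v)⁻¹ * c (n + 1) w v *
      ((τ (n + 1) w)⁻¹ * c (n + 1 + 1) v w * τ (n + 1) v) *
        (c (n + 1) w v * τ n w) * c n v w = 1) (n : ℤ) :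
    ∃ T : V → Q, ∀ v w, L.Adj v w → c (n + N) v w = T w * c n v w * (T v)⁻¹ := by
  -- Accumulated vertical transport from height `n` to `n + k`. Pulling `c (n + k)` back along it
  -- absorbs `τ` and turns the square equations into the recursion for `D`.
  let T : ℕ → V → Q := fun k => k.rec (fun _ => 1) fun j T v => τ (n + j) v * T v
  have T_zero : ∀ v, T 0 v = 1 := fun _ => rfl
  have T_succ : ∀ k v, T (k + 1) v = τ (n + k) v * T k v := fun _ _ => rfl
  refine ⟨T N, fun v w h => ?_⟩
  have key := apply_exponent_of_recursion hN
    (fun k : ℕ => (T k w)⁻¹ * c (n + k) v w * T k v) (fun k => by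
      have h1 := hsq (n + k) v w h
      rw [hc _ v w h] at h1
      simp only [T_succ]
      push_cast
      rw [show n + (k + 2 : ℤ) = n + k + 1 + 1 by ring, ← add_assoc n (k : ℤ) 1]
      have h2 : c (n + k + 1 + 1) v w = τ (n + k + 1) w * c (n + k + 1) v w * τ (n + k) v *
          (c (n + k) v w)⁻¹ * (τ (n + k) w)⁻¹ *
          c (n + k + 1) v w * (τ (n + k + 1) v)⁻¹ := by
        calc _ = τ (n + k + 1) w * c (n + k + 1) v w * τ (n + k) v *
              ((τ (n + k) v)⁻¹ * (c (n + k + 1) v w)⁻¹ *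
              ((τ (n + k + 1) w)⁻¹ * c (n + k + 1 + 1) v w * τ (n + k + 1) v) *
              ((c (n + k + 1) v w)⁻¹ * τ (n + k) w) * c (n + k) v w) * (c (n + k) v w)⁻¹ *
              (τ (n + k) w)⁻¹ * c (n + k + 1) v w * (τ (n + k + 1) v)⁻¹ := by group
          _ = _ := by rw [h1, mul_one]
      rw [h2]
      group)
  simp only [T_zero, Nat.cast_zero, add_zero, inv_one, one_mul, mul_one] at key
  rw [← key]
  group

open CategoryTheory in
theorem map_cornerClass_inv {V : Type u} {W : Type w} {L : SimpleGraph V} {M : SimpleGraph W}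
    {f : M →g L} (hf : IsRegularCover f) {S : Set ℤ} {Q : Type*} [Group Q]
    (Φ : BranchGroupoid f S ⥤ SingleObj Q) {n : ℤ}
    {x y : {x : BBEdge L × Bool // x.1.endpoint x.2 = n}} (h : L.Adj x.1.1.label y.1.1.label) :
    (Φ.map (cornerClass f S (linkCorner h.symm)) : Q) =
      (Φ.map (cornerClass f S (linkCorner h)) : Q)⁻¹ := by
  refine eq_inv_of_mul_eq_one_left ?_
  exact ((Φ.map_comp _ _).symm.trans (congrArg Φ.map (linkCorner_comp_symm hf S h))).trans
    (Φ.map_id _)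

open CategoryTheory in
theorem map_cornerClass_four {V : Type u} {W : Type w} {L : SimpleGraph V} {M : SimpleGraph W}
    {f : M →g L} (hf : IsRegularCover f) {S : Set ℤ} {Q : Type*} [Group Q]
    (Φ : BranchGroupoid f S ⥤ SingleObj Q) {n : ℤ}
    {x y x' y' : {x : BBEdge L × Bool // x.1.endpoint x.2 = n}}
    (h₁ : L.Adj x.1.1.label y.1.1.label) (h₂ : L.Adj y.1.1.label x'.1.1.label)
    (h₃ : L.Adj x'.1.1.label y'.1.1.label) (h₄ : L.Adj y'.1.1.label x.1.1.label)
    (hx : x.1.1.label = x'.1.1.label) :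
    (Φ.map (cornerClass f S (linkCorner h₄)) : Q) * (Φ.map (cornerClass f S (linkCorner h₃)) : Q) *
      (Φ.map (cornerClass f S (linkCorner h₂)) : Q) *
        (Φ.map (cornerClass f S (linkCorner h₁)) : Q) = 1 := by
  have h : cornerClass f S (linkCorner h₁) ≫ cornerClass f S (linkCorner h₂) ≫
      cornerClass f S (linkCorner h₃) ≫ cornerClass f S (linkCorner h₄) = 𝟙 _ :=
    linkPath_eq_id _ (liftsToLoop_four hf (n := n) (x := x) (y := y) h₁ h₂ h₃ h₄ hx)
  have h' := (congrArg Φ.map h).trans (Φ.map_id _)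
  rw [Φ.map_comp, Φ.map_comp, Φ.map_comp] at h'
  exact h'

/-- The descending end at height `n + 1` of the edge with bottom `n` and label `v`. -/
def descendingEnd {V : Type u} (L : SimpleGraph V) (n : ℤ) (v : V) :
    {x : BBEdge L × Bool // x.1.endpoint x.2 = n + 1} :=
  ⟨(⟨n, v⟩, true), rfl⟩

open CategoryTheory in
/-- Loops in the ascending links at heights that differ by `N` have conjugate images in every group
of exponent `N`. -/
theorem map_ascendingClass_add_exponent {V : Type u} {W : Type w} {L : SimpleGraph V}
    {M : SimpleGraph W} {f : M →g L} (hf : IsRegularCover f) (hV : ∀ v, ∃ w, L.Adj v w)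
    {S : Set ℤ} {Q : Type*} [Group Q] (Φ : BranchGroupoid f S ⥤ SingleObj Q) {N : ℕ}
    (hN : ∀ q : Q, q ^ N = 1) (n : ℤ) :
    ∃ T : V → Q, ∀ {v w : V} (γ : L.Walk v w), (Φ.map (ascendingClass f S (n + N) γ) : Q) =
      T w * (Φ.map (ascendingClass f S n γ) : Q) * (T v)⁻¹ := by
  classical
  choose nb hnb using hV
  let κ : ∀ {n : ℤ} (x y : {x : BBEdge L × Bool // x.1.endpoint x.2 = n}),
      L.Adj x.1.1.label y.1.1.label → Q := fun x y h => Φ.map (cornerClass f S (linkCorner h))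
  have κ_inv : ∀ {n : ℤ} (x y : {x : BBEdge L × Bool // x.1.endpoint x.2 = n})
      (h : L.Adj x.1.1.label y.1.1.label), κ y x h.symm = (κ x y h)⁻¹ :=
    fun x y h => map_cornerClass_inv hf Φ h
  have κ_four : ∀ {n : ℤ} (x y x' y' : {x : BBEdge L × Bool // x.1.endpoint x.2 = n}) (h₁ h₂ h₃ h₄),
      x.1.1.label = x'.1.1.label → κ y' x h₄ * κ x' y' h₃ * κ y x' h₂ * κ x y h₁ = 1 :=
    fun x y x' y' h₁ h₂ h₃ h₄ hx => map_cornerClass_four hf Φ h₁ h₂ h₃ h₄ hx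
  let A : ∀ n : ℤ, V → {x : BBEdge L × Bool // x.1.endpoint x.2 = n} := fun n => ascendingLink L n
  let c : ℤ → V → V → Q := fun n v w => if h : L.Adj v w then κ (A n v) (A n w) h else 1
  have c_eq : ∀ n v w (h : L.Adj v w), κ (A n v) (A n w) h = c n v w :=
    fun n v w h => (dif_pos h).symm
  -- Passage at height `n + 1` from the descending to the ascending end labelled `v`. These ends are
  -- not adjacent in the link, so the path goes through an auxiliary neighbour; the 4-cycle relation
  -- makes the choice harmless.
  let τ : ℤ → V → Q := fun n v => κ (A (n + 1) (nb v)) (A (n + 1) v) (hnb v).symm *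
    κ (descendingEnd L n v) (A (n + 1) (nb v)) (hnb v)
  have hc : ∀ n v w, L.Adj v w → c n w v = (c n v w)⁻¹ := by
    intro n v w h
    rw [← c_eq n v w h, ← c_eq n w v h.symm]
    exact κ_inv _ _ h
  -- With `up_down` and `down_down`, this expresses every corner through `c` and `τ`, so the square
  -- relation becomes the hypothesis of `exists_gauge_add_exponent`.
  have down_up : ∀ n v w (h : L.Adj v w),
      κ (descendingEnd L n v) (A (n + 1) w) h = c (n + 1) v w * τ n v := by
    intro n v w h
    have h1 := κ_four (descendingEnd L n v) (A (n + 1) w) (A (n + 1) v) (A (n + 1) (nb v))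
      h h.symm (hnb v) (hnb v).symm rfl
    rw [κ_inv (descendingEnd L n v) (A (n + 1) (nb v)) (hnb v),
      κ_inv (A (n + 1) v) (A (n + 1) w) h, c_eq (n + 1) v w h] at h1
    change _ = _ * (κ (A (n + 1) (nb v)) (A (n + 1) v) (hnb v).symm *
      κ (descendingEnd L n v) (A (n + 1) (nb v)) (hnb v))
    rw [κ_inv (A (n + 1) v) (A (n + 1) (nb v)) (hnb v), eq_inv_of_mul_eq_one_right h1]
    group
  have up_down : ∀ n v w (h : L.Adj v w),
      κ (A (n + 1) w) (descendingEnd L n v) h.symm = (τ n v)⁻¹ * c (n + 1) w v := by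
    intro n v w h
    rw [κ_inv (descendingEnd L n v) (A (n + 1) w) h, down_up, mul_inv_rev, ← hc _ _ _ h]
  have down_down : ∀ n v w (h : L.Adj v w),
      κ (descendingEnd L n v) (descendingEnd L n w) h =
        (τ n w)⁻¹ * c (n + 1) v w * τ n v := by
    intro n v w h
    have h1 := κ_four (descendingEnd L n v) (descendingEnd L n w) (A (n + 1) v) (A (n + 1) w)
      h h.symm h h.symm rfl
    rw [up_down n v w h, down_up n w v h.symm, c_eq, hc _ _ _ h] at h1
    rw [eq_inv_of_mul_eq_one_right h1]
    group
  obtain ⟨T, hT⟩ := exists_gauge_add_exponent hN L c τ hc (by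
    intro n v w h
    have h1 : (Quotient.functor (BranchRel f S)).map (bbSquarePath n h) = 𝟙 _ :=
      CategoryTheory.Quotient.sound _ (.square n h)
    have h2 := (congrArg Φ.map h1).trans (Φ.map_id _)
    have h3 : κ (A (n + 1) w) (descendingEnd L n v) h.symm *
        (κ (descendingEnd L (n + 1) v) (descendingEnd L (n + 1) w) h *
        (κ (descendingEnd L n w) (A (n + 1) v) h.symm * κ (A n v) (A n w) h)) = 1 := by
      refine Eq.trans ?_ h2
      have h4 : (Quotient.functor (BranchRel f S)).map (bbSquarePath n h) =
          ((cornerClass f S (linkCorner (x := A n v) (y := A n w) h) ≫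
          cornerClass f S (linkCorner (x := descendingEnd L n w) (y := A (n + 1) v) h.symm)) ≫
          cornerClass f S (linkCorner (x := descendingEnd L (n + 1) v)
            (y := descendingEnd L (n + 1) w) h)) ≫
          cornerClass f S (linkCorner (x := A (n + 1) w) (y := descendingEnd L n v) h.symm) := rfl
      rw [h4]
      exact ((Φ.map_comp _ _).trans (congrArg (· ≫ _) ((Φ.map_comp _ _).trans
        (congrArg (· ≫ _) (Φ.map_comp _ _))))).symm
    rw [up_down n v w h, down_up n w v h.symm, down_down (n + 1) v w h, c_eq] at h3
    simpa only [mul_assoc] using h3) n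
  refine ⟨T, fun {v w} γ => ?_⟩
  have cons_eq : ∀ m {v w z : V} (h : L.Adj v w) (γ : L.Walk w z),
      (Φ.map (ascendingClass f S m (γ.cons h)) : Q) =
        (Φ.map (ascendingClass f S m γ) : Q) * c m v w := by
    intro m v w z h γ
    rw [← c_eq m v w h]
    exact Φ.map_comp (cornerClass f S (linkCorner (x := A m v) (y := A m w) h))
      (ascendingClass f S m γ)
  induction γ with
  | nil =>
    have h1 : ∀ m v, (Φ.map (ascendingClass f S m (.nil : L.Walk v v)) : Q) = 1 :=
      fun _ _ => Φ.map_id _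
    rw [h1, h1]
    group
  | cons h γ ih =>
    rw [cons_eq, cons_eq, ih, hT _ _ h]
    group

/-! ### The torsion loops and the conclusion -/

-- Concatenating the translates of `q` by powers of `g` lifts the `j`-th power of `γ` to a path from
-- `a` to `g ^ j a`, which closes up when `j` is a positive exponent killing `g`.
open CategoryTheory in
theorem isOfFinOrder_ascendingClass {V : Type u} {W : Type w} {L : SimpleGraph V}
    {M : SimpleGraph W} {f : M →g L} (S : Set ℤ) (n : ℤ) {v : V} (γ : L.Walk v v) {g : M ≃g M}
    (hg : g ∈ coverDeckGroup f) (hfin : IsOfFinOrder g) {a : W} (q : M.Walk a (g a))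
    (hq : q.support.map f = γ.support) :
    IsOfFinOrder (G := End (⟨(⟨n, v⟩ : BBEdge L)⟩ : BranchGroupoid f S))
      (ascendingClass f S n γ) := by
  let m : End (⟨(⟨n, v⟩ : BBEdge L)⟩ : BranchGroupoid f S) := ascendingClass f S n γ
  have key : ∀ j : ℕ, ∃ (γ' : L.Walk v v) (q' : M.Walk a ((g ^ j) a)),
      q'.support.map f = γ'.support ∧
        m ^ j = ascendingClass f S n γ' := by
    intro j
    induction j with
    | zero =>
      refine ⟨.nil, .nil, ?_, rfl⟩
      have := congrArg List.head? hq
      rw [← q.cons_tail_support, ← γ.cons_tail_support] at this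
      exact congrArg (fun x => [x]) (Option.some.inj this)
    | succ j ih =>
      obtain ⟨γ', q', h1, h2⟩ := ih
      have e : (g ^ j) (g a) = (g ^ (j + 1)) a := by rw [pow_succ, RelIso.mul_apply]
      have hgj : (g ^ j) ∈ coverDeckGroup f := pow_mem hg j
      refine ⟨γ'.append γ, (q'.append (q.map (g ^ j).toHom)).copy rfl e, ?_, ?_⟩
      · have h3 : (q.map (g ^ j).toHom).support.map f = γ.support := by
          rw [SimpleGraph.Walk.support_map, List.map_map, ← hq]
          exact List.map_congr_left fun x _ => hgj x
        rw [SimpleGraph.Walk.support_copy, SimpleGraph.Walk.support_append,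
          SimpleGraph.Walk.support_append, List.map_append, List.map_tail, h1, h3]
      · rw [pow_succ', h2, ascendingClass_append]
        rfl
  obtain ⟨k, hk, hgk⟩ := isOfFinOrder_iff_pow_eq_one.mp hfin
  obtain ⟨γ', q', h1, h2⟩ := key k
  refine isOfFinOrder_iff_pow_eq_one.mpr ⟨k, hk, h2.trans ?_⟩
  refine linkPath_eq_id _ ⟨a, q'.copy rfl (by rw [hgk]; rfl), ?_⟩
  rw [SimpleGraph.Walk.support_copy, h1, SimpleGraph.Walk.support_map, List.map_map]
  exact (List.map_id _).symm

theorem theorem3p1 {V : Type*} [Finite V] {W : Type*} (L : SimpleGraph V) (hL : L.Connected)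
    (M : SimpleGraph W) (f : M →g L) (hf : IsRegularCover f) (S : Set ℤ) (e₀ : BBEdge L)
    (hram : FiniteRamification f S) (hG : IsVirtuallyTorsionFree (GenBestvinaBrady f S e₀)) :
    IsPeriodicSet S := by
  have := hram.finite
  have := hram.nontrivial
  obtain ⟨g, hg⟩ := exists_ne (1 : coverDeckGroup f)
  have hga : ∀ a, a ≠ g.1 a := fun a h => hg (Subtype.ext (coverDeckGroup_eq_one hf g.2 h.symm))
  -- Since `g` moves every vertex of the connected graph `M`, a path from a lift of `v` to its
  -- translate has a first edge.
  have hV : ∀ v, ∃ w, L.Adj v w := by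
    intro v
    obtain ⟨a, rfl⟩ := hf.surjective v
    obtain ⟨q⟩ := hf.connected.preconnected a (g.1 a)
    have hne := hga a
    generalize g.1 a = b at q hne
    cases q with
    | nil => exact absurd rfl hne
    | cons h _ => exact ⟨_, f.map_adj h⟩
  obtain ⟨Q, _, _, Φ, hΦ⟩ := exists_functor_finite_group (BranchGroupoid.isIso hf)
    (BranchGroupoid.nonempty_iso hL hf S hV) ⟨e₀⟩
    (hG.of_injective BranchGroupoid.toDeck BranchGroupoid.toDeck_injective)
  obtain ⟨a⟩ := hf.connected.nonempty
  obtain ⟨q⟩ := hf.connected.preconnected a (g.1 a)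
  let γ : L.Walk (f a) (f a) := (q.map f).copy rfl (g.2 a)
  have hq : q.support.map f = γ.support := by
    rw [SimpleGraph.Walk.support_copy, SimpleGraph.Walk.support_map]
  have hfin : IsOfFinOrder g.1 := (coverDeckGroup f).subtype.isOfFinOrder (isOfFinOrder_of_finite g)
  -- Membership in `S` is detected in the finite group `Q` by one fixed loop `γ`, at every height.
  have mem_iff : ∀ n, n ∈ S ↔ Φ.map (ascendingClass f S n γ) = (1 : Q) := by
    intro n
    constructor
    · intro hn
      exact (congrArg Φ.map (CategoryTheory.Quotient.sound _ (BranchRel.unbranched n hn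
        (γ.map (ascendingLink L n))))).trans (Φ.map_id _)
    · intro h
      by_contra hn
      exact ascendingClass_ne_id hf hn γ (hga a) q hq
        (hΦ _ _ (isOfFinOrder_ascendingClass S n γ g.2 hfin q hq) h)
  refine ⟨Nat.card Q, by exact_mod_cast Nat.card_pos, fun n => ?_⟩
  obtain ⟨T, hT⟩ := map_ascendingClass_add_exponent hf hV Φ (N := Nat.card Q)
    (fun q => pow_card_eq_one') n
  rw [mem_iff, mem_iff, hT γ, conj_eq_one_iff]
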